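/- Let $(\Omega,\mathcal M,\mu)$ be a measure space, let $0<p<\infty$, and let $L^p=L^p(\mu)$ be the space of $\mu$-a.e. classes of $p$-integrable functions with values in $\mathbb K=\mathbb R$ or $\mathbb C$, with its natural topology (given by the metric $\|f-g\|_p$ if $p\ge 1$ and $\int_\Omega|f-g|^p\,d\mu$ if $p<1$). A subset $A$ of a topological vector space $X$ is called *maximal dense-lineable* in $X$ if $A\cup\{0\}$ contains a dense vector subspace $M$ of $X$ with $\dim M=\dim X$. Put $$L^p_{r\text{-}strict}=L^p\setminus\bigcup_{q\in(p,\infty]}L^q,\qquad L^p_{l\text{-}strict}=L^p\setminus\bigcup_{q\in(0,p)}L^q,\qquad L^p_{strict}=L^p\setminus\bigcup_{q\in(0,\infty]\setminus\{p\}}L^q .$$ Let $\mathcal M_f=\{S\in\mathcal M:\mu(S)<\infty\}$, and let $\mathrm{ent}(\Omega)$ be the cardinality of the set of classes of $\mathcal M_f$ under the equivalence relation $\mu((C\setminus D)\cup(D\setminus C))=0$. Consider the conditions $$[\alpha]\quad \inf\{\mu(S):S\in\mathcal M,\ \mu(S)>0\}=0,\qquad\qquad [\beta]\quad \sup\{\mu(S):S\in\mathcal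 M,\ \mu(S)<\infty\}=\infty,$$ and, for $S\in\mathcal M$, $$[\alpha_S]\quad \inf\{\mu(C):C\in\mathcal M,\ C\subset S,\ \mu(C)>0\}=0$$ (with $\inf\emptyset=\infty$). A family $\mathcal S\subset\mathcal M$ is *$\mu$-disjoint* if $\mu(C)>0$ for all $C\in\mathcal S$ and $\mu(C\cap D)=0$ for all different $C,D\in\mathcal S$. Let $\mathfrak c$ be the cardinality of the continuum. If $\mathrm{ent}(\Omega)>\mathfrak c$, assume that there is a $\mu$-disjoint family $\mathcal S\subset\mathcal M$ with $\mathrm{card}(\mathcal S)=\mathrm{ent}(\Omega)$, and fix it. Then the following hold, where maximal dense-lineability is meant in $L^p$: (a) If $[\alpha]$ holds and $\mathrm{ent}(\Omega)\le\mathfrak c$, then $L^p_{r\text{-}strict}$ is maximal dense-lineable. (b) If $\mathrm{ent}(\Omega)>\mathfrak c$ and $[\alpha_S]$ holds for every $S\in\mathcal S$, then $L^p_{r\text{-}strict}$ is maximal dense-lineable. (c) If $[\beta]$ holds and $\mathrm{ent}(\Omega)\le\mathfrak c$, then $L^p_{l\text{-}strict}$ is maximal dense-lineable. (d) If $\mathrm{ent}(\Omega)>\mathfrak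 c$ and $\mathcal S\subset\mathcal M_f$, then $L^p_{l\text{-}strict}$ is maximal dense-lineable. (e) If $\mathrm{ent}(\Omega)\le\mathfrak c$ and both $[\alpha]$ and $[\beta]$ hold, then $L^p_{strict}$ is maximal dense-lineable. (f) If $\mathrm{ent}(\Omega)>\mathfrak c$, $\mathcal S\subset\mathcal M_f$ and $[\alpha_S]$ holds for every $S\in\mathcal S$, then $L^p_{strict}$ is maximal dense-lineable. -/

import Mathlib

open MeasureTheory Cardinal
open scoped ENNReal

noncomputable section

namespace StrictLp

variable {Ω : Type*} [MeasurableSpace Ω]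

/-- The measurable sets of finite measure. -/
def FinSets (μ : Measure Ω) : Type _ := {S : Set Ω // MeasurableSet S ∧ μ S < ∞}

/-- Two measurable sets of finite measure are identified when their symmetric difference
`(C \ D) ∪ (D \ C)` is null. -/
def finSetsSetoid (μ : Measure Ω) : Setoid (FinSets μ) where
  r C D := μ ((C.1 \ D.1) ∪ (D.1 \ C.1)) = 0
  iseqv :=
    { refl := fun C => by simp
      symm := fun {C D} h => by rw [Set.union_comm]; exact h
      trans := fun {C D E} h₁ h₂ => by
        refine measure_mono_null ?_ (measure_union_null h₁ h₂)
        intro x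
        simp only [Set.mem_union, Set.mem_sdiff]
        tauto }

/-- The entropy of a measure space: the number of classes of measurable sets of finite measure
modulo null sets. -/
def ent {Ω : Type*} [MeasurableSpace Ω] (μ : Measure Ω) : Cardinal :=
  #(Quotient (finSetsSetoid μ))

/-- A family of measurable sets of positive measure whose pairwise intersections are null. -/
def MuDisjoint (μ : Measure Ω) (F : Set (Set Ω)) : Prop :=
  (∀ C ∈ F, MeasurableSet C ∧ 0 < μ C) ∧ ∀ C ∈ F, ∀ D ∈ F, C ≠ D → μ (C ∩ D) = 0

/-- Condition `[α]`: the infimum of the positive measures of measurable sets is zero. The infimum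
is taken in `[0, ∞]`, so that it is `∞` if no set has positive measure. -/
def CondAlpha (μ : Measure Ω) : Prop :=
  sInf {m : ℝ≥0∞ | ∃ S, MeasurableSet S ∧ 0 < μ S ∧ μ S = m} = 0

/-- Condition `[α_S]`: condition `[α]` for the measurable subsets of `S`. -/
def CondAlphaOn (μ : Measure Ω) (S : Set Ω) : Prop :=
  sInf {m : ℝ≥0∞ | ∃ C, MeasurableSet C ∧ C ⊆ S ∧ 0 < μ C ∧ μ C = m} = 0

/-- Condition `[β]`: the supremum of the finite measures of measurable sets is infinite. -/
def CondBeta (μ : Measure Ω) : Prop :=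
  sSup {m : ℝ≥0∞ | ∃ S, MeasurableSet S ∧ μ S < ∞ ∧ μ S = m} = ∞

/-- A subset `A` of a vector space `X` with a topology `τ` is maximal dense-lineable if `A ∪ {0}`
contains a dense vector subspace `M` of `X` with `dim M = dim X`. -/
def MaximalDenseLineable (𝕂 : Type*) {X : Type*} [Field 𝕂] [AddCommGroup X] [Module 𝕂 X]
    (τ : TopologicalSpace X) (A : Set X) : Prop :=
  ∃ M : Submodule 𝕂 X, (M : Set X) ⊆ A ∪ {0} ∧ @Dense X τ (M : Set X) ∧
    Module.rank 𝕂 M = Module.rank 𝕂 X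

section Lp

variable {𝕂 : Type*} [RCLike 𝕂] {μ : Measure Ω}

/-- The F-norm of `L^p`: it is `(∫ |f|^p)^(1/p)` for `1 ≤ p` and `∫ |f|^p` for `0 < p < 1`. -/
def fnorm (p : ℝ≥0∞) (f : Lp 𝕂 p μ) : ℝ≥0∞ :=
  if 1 ≤ p then eLpNorm f p μ else ∫⁻ x, ‖f x‖ₑ ^ p.toReal ∂μ

theorem fnorm_zero {p : ℝ≥0∞} (hp : p ≠ 0) : fnorm p (0 : Lp 𝕂 p μ) = 0 := by
  unfold fnorm
  split_ifs with h
  · rw [eLpNorm_congr_ae (Lp.coeFn_zero 𝕂 p μ)]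
    simp
  · have ht : 0 < p.toReal := ENNReal.toReal_pos hp (by rintro rfl; simp at h)
    rw [lintegral_eq_zero_iff' ((Lp.aestronglyMeasurable _).enorm.pow_const _)]
    filter_upwards [Lp.coeFn_zero 𝕂 p μ] with x hx
    rw [hx]
    simp [ht]

theorem fnorm_neg {p : ℝ≥0∞} (f : Lp 𝕂 p μ) : fnorm p (-f) = fnorm p f := by
  unfold fnorm
  split_ifs with h
  · rw [eLpNorm_congr_ae (Lp.coeFn_neg f), eLpNorm_neg]
  · refine lintegral_congr_ae ?_
    filter_upwards [Lp.coeFn_neg f] with x hx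
    rw [hx]
    simp

theorem fnorm_add_le {p : ℝ≥0∞} (f g : Lp 𝕂 p μ) :
    fnorm p (f + g) ≤ fnorm p f + fnorm p g := by
  unfold fnorm
  split_ifs with h
  · rw [eLpNorm_congr_ae (Lp.coeFn_add f g)]
    exact eLpNorm_add_le (Lp.aestronglyMeasurable f) (Lp.aestronglyMeasurable g) h
  · rw [← lintegral_add_left' ((Lp.aestronglyMeasurable f).enorm.pow_const _)]
    refine lintegral_mono_ae ?_
    filter_upwards [Lp.coeFn_add f g] with x hx
    rw [hx]
    have h1 : p.toReal ≤ 1 := ENNReal.toReal_mono (by simp) (not_le.mp h).le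
    exact (ENNReal.rpow_le_rpow (enorm_add_le _ _) ENNReal.toReal_nonneg).trans
      (ENNReal.rpow_add_le_add_rpow _ _ ENNReal.toReal_nonneg h1)

/-- The (extended) metric `d(f, g) = ‖f - g‖` of `L^p` given by the F-norm, for `0 < p`. -/
@[reducible] def lpEMetric (𝕂 : Type*) [RCLike 𝕂] (p : ℝ≥0∞) (μ : Measure Ω) (hp : p ≠ 0) :
    PseudoEMetricSpace (Lp 𝕂 p μ) where
  edist f g := fnorm p (f - g)
  edist_self f := by rw [sub_self, fnorm_zero hp]
  edist_comm f g := by rw [← fnorm_neg, neg_sub]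
  edist_triangle f g h := by
    rw [← sub_add_sub_cancel f g h]
    exact fnorm_add_le _ _

/-- The natural topology of `L^p`, for `0 < p`. -/
@[reducible] def lpTopology (𝕂 : Type*) [RCLike 𝕂] (p : ℝ≥0∞) (μ : Measure Ω) (hp : p ≠ 0) :
    TopologicalSpace (Lp 𝕂 p μ) :=
  (lpEMetric 𝕂 p μ hp).toUniformSpace.toTopologicalSpace

/-- `L^p` minus the union of all `L^q` with `p < q ≤ ∞`. -/
def rStrict (𝕂 : Type*) [RCLike 𝕂] (p : ℝ≥0∞) (μ : Measure Ω) : Set (Lp 𝕂 p μ) :=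
  {f | ∀ q : ℝ≥0∞, p < q → (f : Ω →ₘ[μ] 𝕂) ∉ Lp 𝕂 q μ}

/-- `L^p` minus the union of all `L^q` with `0 < q < p`. -/
def lStrict (𝕂 : Type*) [RCLike 𝕂] (p : ℝ≥0∞) (μ : Measure Ω) : Set (Lp 𝕂 p μ) :=
  {f | ∀ q : ℝ≥0∞, 0 < q → q < p → (f : Ω →ₘ[μ] 𝕂) ∉ Lp 𝕂 q μ}

/-- `L^p` minus the union of all `L^q` with `0 < q ≤ ∞` and `q ≠ p`. -/
def strict (𝕂 : Type*) [RCLike 𝕂] (p : ℝ≥0∞) (μ : Measure Ω) : Set (Lp 𝕂 p μ) :=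
  {f | ∀ q : ℝ≥0∞, 0 < q → q ≠ p → (f : Ω →ₘ[μ] 𝕂) ∉ Lp 𝕂 q μ}

end Lp

end StrictLp

end

/-! The problem reduces to finding a family in `L^p`, at least as numerous as `L^p` itself, that is
linearly independent modulo each excluded `L^q`. Simple functions in `L^p` lie in every `L^q` and
are dense. Adding small multiples of the family to them keeps independence modulo `L^q` and produces
a dense set, whose span meets each excluded `L^q` only in `0` (`maximalDenseLineable_avoiding`).

An element of `L^p` is determined by countably many classes of sets of finite measure, so `L^p`
embeds in the sequences `ℕ → A`, with `A = Bool` for entropy at most `𝔠` and `A = F` otherwise.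
These sequences are the branches of the tree `List A`, and only the nodes need disjoint sets. The
function of a branch is constant on the set of each of its nodes and contributes `2 ^ (-n)` to `∫
|f|^p` at level `n`. Distinct branches share finitely many nodes, so far along one branch a finite
linear combination sees that branch alone (`linearIndependent_mkQ`). Node measures at most `2 ^ (-n
^ 2)` at infinitely many levels exclude `L^q` for `q > p`; measures at least `2 ^ (n ^ 2)` exclude
`q < p`; alternating by parity excludes both.

For small entropy the node sets come from disjointifying those given by `[α]` and `[β]`. For large
entropy they come from `F`, split into blocks by a bijection with `List F × ℕ`; large sets need a
uniform lower bound on enough members of `F`, which follows from König's inequality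
(`exists_mk_le_inv_two_pow_le`). -/

noncomputable section

namespace StrictLp

/-! ### Dense subspaces from families independent modulo `L^q`. -/

section DenseSubspace

variable {Ω 𝕂 : Type*} [MeasurableSpace Ω] [RCLike 𝕂] {μ : Measure Ω} {p : ℝ≥0∞}

/-- The subspace of `L^p` formed by the elements that also belong to `L^q`. -/
def interLq (𝕂 : Type*) [RCLike 𝕂] (p : ℝ≥0∞) (μ : Measure Ω) (q : ℝ≥0∞) :
    Submodule 𝕂 (Lp 𝕂 p μ) where
  carrier := {f | (f : Ω →ₘ[μ] 𝕂) ∈ Lp 𝕂 q μ}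
  zero_mem' := (Lp 𝕂 q μ).zero_mem
  add_mem' := fun hf hg => (Lp 𝕂 q μ).add_mem hf hg
  smul_mem' := fun c _ hf => (Lp.LpSubmodule 𝕂 𝕂 q μ).smul_mem c hf

theorem mem_interLq {q : ℝ≥0∞} {f : Lp 𝕂 p μ} :
    f ∈ interLq 𝕂 p μ q ↔ (f : Ω →ₘ[μ] 𝕂) ∈ Lp 𝕂 q μ := Iff.rfl

/-- The elements of `L^p` that do not belong to `L^q` for any `q` in `Q`. -/
def avoiding (𝕂 : Type*) [RCLike 𝕂] (p : ℝ≥0∞) (μ : Measure Ω) (Q : Set ℝ≥0∞) :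
    Set (Lp 𝕂 p μ) :=
  {f | ∀ q ∈ Q, f ∉ interLq 𝕂 p μ q}

/-- For `p < 1` the F-norm is the `p`-th power of `eLpNorm`. This lets smallness be checked on
`eLpNorm` for all `p` at once. -/
theorem exists_fnorm_lt_of_eLpNorm_lt (hp : p ≠ 0) {ε : ℝ≥0∞} (hε : ε ≠ 0) :
    ∃ δ ≠ 0, ∀ f : Lp 𝕂 p μ, eLpNorm f p μ < δ → fnorm p f < ε := by
  by_cases h : 1 ≤ p
  · exact ⟨ε, hε, fun f hf => by simpa [fnorm, h] using hf⟩
  · have hp' : p ≠ ∞ := by rintro rfl; simp at h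
    have ht : 0 < p.toReal := ENNReal.toReal_pos hp hp'
    refine ⟨ε ^ (1 / p.toReal), ?_, fun f hf => ?_⟩
    · simp only [one_div, ne_eq, ENNReal.rpow_eq_zero_iff, not_or, not_and]
      exact ⟨fun h => (hε h).elim, fun _ => not_lt.mpr (inv_nonneg.mpr ht.le)⟩
    · rw [eLpNorm_eq_lintegral_rpow_enorm_toReal hp hp',
        ENNReal.rpow_lt_rpow_iff (by positivity)] at hf
      simpa [fnorm, h] using hf

theorem exists_unit_fnorm_smul_lt (hp : p ≠ 0) (f : Lp 𝕂 p μ) {ε : ℝ≥0∞} (hε : ε ≠ 0) :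
    ∃ t : 𝕂ˣ, fnorm p (t • f) < ε := by
  obtain ⟨δ, hδ, h⟩ := exists_fnorm_lt_of_eLpNorm_lt (𝕂 := 𝕂) (μ := μ) hp hε
  obtain ⟨t, ht, hlt⟩ := ENNReal.exists_nnreal_pos_mul_lt (Lp.eLpNorm_ne_top f) hδ
  have ht0 : (((t : ℝ) : 𝕂)) ≠ 0 := by simpa using ht.ne'
  refine ⟨Units.mk0 _ ht0, h _ ?_⟩
  rw [Units.smul_mk0, eLpNorm_congr_ae (Lp.coeFn_smul _ f), eLpNorm_const_smul]
  convert hlt using 2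
  rw [enorm_eq_nnnorm]
  congr 1
  ext
  simp

theorem exists_mem_interLq_fnorm_sub_lt (hp : p ≠ 0) (hp' : p ≠ ∞) (f : Lp 𝕂 p μ) {ε : ℝ≥0∞}
    (hε : ε ≠ 0) :
    ∃ g : Lp 𝕂 p μ, (∀ q, g ∈ interLq 𝕂 p μ q) ∧ fnorm p (f - g) < ε := by
  obtain ⟨δ, hδ, h⟩ := exists_fnorm_lt_of_eLpNorm_lt (𝕂 := 𝕂) (μ := μ) hp hε
  obtain ⟨g, hg, hgp⟩ := (Lp.memLp f).exists_simpleFunc_eLpNorm_sub_lt hp' hδ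
  refine ⟨hgp.toLp, fun q => ?_, h _ ?_⟩
  · rw [mem_interLq, Lp.mem_Lp_iff_memLp]
    exact (SimpleFunc.memLp_of_finite_measure_preimage q
      ((SimpleFunc.memLp_iff hp hp').1 hgp)).ae_eq hgp.coeFn_toLp.symm
  · refine lt_of_eq_of_lt (eLpNorm_congr_ae ?_) hg
    exact (Lp.coeFn_sub _ _).trans (Filter.EventuallyEq.rfl.sub hgp.coeFn_toLp)

/-- A family in `L^p`, at least as large as `L^p` and linearly independent modulo each `L^q`, can
be perturbed into a basis of a dense subspace whose nonzero elements avoid each `L^q`. -/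
theorem maximalDenseLineable_avoiding (hp : p ≠ 0) (hp' : p ≠ ∞) {Q : Set ℝ≥0∞}
    (hQ : Q.Nonempty) {I : Type*} (φ : Lp 𝕂 p μ × ℕ → I) (hφ : Function.Injective φ)
    (f : I → Lp 𝕂 p μ)
    (hf : ∀ q ∈ Q, LinearIndependent 𝕂 ((interLq 𝕂 p μ q).mkQ ∘ f)) :
    MaximalDenseLineable 𝕂 (lpTopology 𝕂 p μ hp) (avoiding 𝕂 p μ Q) := by
  classical
  -- A surjection onto pairs: every target in `L^p` is paired with every precision `1 / (n + 1)` by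
  -- some index.
  let ψ : I → Lp 𝕂 p μ × ℕ := Function.invFun φ
  have hψ : Function.Surjective ψ := Function.invFun_surjective hφ
  -- Targets outside some `L^q` are replaced by `0`, so that `v i` always vanishes modulo `L^q`.
  let v : I → Lp 𝕂 p μ := fun i => if ∀ q, (ψ i).1 ∈ interLq 𝕂 p μ q then (ψ i).1 else 0
  have hv : ∀ i q, v i ∈ interLq 𝕂 p μ q := by
    intro i q
    by_cases h : ∀ q, (ψ i).1 ∈ interLq 𝕂 p μ q
    · simpa only [v, if_pos h] using h q
    · simp only [v, if_neg h, Submodule.zero_mem]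
  choose t ht using fun i => exists_unit_fnorm_smul_lt hp (f i)
    (ε := ((ψ i).2 + 1 : ℝ≥0∞)⁻¹) (by simp)
  let g : I → Lp 𝕂 p μ := fun i => v i + t i • f i
  have hg : ∀ q ∈ Q, LinearIndependent 𝕂 ((interLq 𝕂 p μ q).mkQ ∘ g) := by
    intro q hq
    have : (interLq 𝕂 p μ q).mkQ ∘ g = t • ((interLq 𝕂 p μ q).mkQ ∘ f) := by
      funext i
      have h0 : (interLq 𝕂 p μ q).mkQ (v i) = 0 := by
        simpa using hv i q
      simp only [Function.comp_apply, g, map_add, h0, zero_add, Pi.smul_apply', Units.smul_def,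
        map_smul]
    rw [this]
    exact (hf q hq).units_smul t
  obtain ⟨q₀, hq₀⟩ := hQ
  have hgli : LinearIndependent 𝕂 g := (hg q₀ hq₀).of_comp _
  refine ⟨Submodule.span 𝕂 (Set.range g), fun x hx => ?_, ?_, le_antisymm (Submodule.rank_le _) ?_⟩
  · by_cases hx0 : x = 0
    · exact Or.inr hx0
    · refine Or.inl fun q hq hxq => hx0 ?_
      -- Independence of the images makes the span disjoint from the kernel of the quotient map,
      -- which is `L^q`.
      refine Submodule.disjoint_def.1 (Submodule.range_ker_disjoint (hg q hq)) x hx ?_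
      simpa using hxq
  · refine (@EMetric.dense_iff _ (lpEMetric 𝕂 p μ hp) _).2 fun x r hr => ?_
    obtain ⟨w, hw, hxw⟩ := exists_mem_interLq_fnorm_sub_lt hp hp' x
      (ENNReal.half_pos hr.ne').ne'
    obtain ⟨n, hn⟩ := ENNReal.exists_inv_nat_lt (ENNReal.half_pos hr.ne').ne'
    obtain ⟨i, hi⟩ := hψ (w, n)
    refine ⟨g i, ?_, Submodule.subset_span ⟨i, rfl⟩⟩
    have hvi : v i = w := by
      have : (ψ i).1 = w := by rw [hi]
      simp only [v, this]
      exact if_pos hw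
    have hti : fnorm p (t i • f i) < r / 2 := by
      refine ((ht i).trans_le ?_).trans hn
      rw [hi]
      exact ENNReal.inv_le_inv.2 le_self_add
    change fnorm p (g i - x) < r
    have : g i - x = -(x - w) + t i • f i := by simp only [g, hvi]; abel
    rw [this]
    refine (fnorm_add_le _ _).trans_lt ?_
    rw [fnorm_neg]
    exact (ENNReal.add_lt_add hxw hti).trans_eq (ENNReal.add_halves r)
  · have h1 : LinearIndependent 𝕂
        (fun i => (⟨g i, Submodule.subset_span ⟨i, rfl⟩⟩ : Submodule.span 𝕂 (Set.range g))) :=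
      LinearIndependent.of_comp (Submodule.span 𝕂 (Set.range g)).subtype hgli
    -- The rank of `L^p` is at most its cardinality, hence at most that of `I`, and the span has `I`
    -- independent vectors.
    refine (rank_le_card 𝕂 _).trans ?_
    refine Cardinal.lift_le.1 (le_trans ?_ h1.cardinal_lift_le_rank)
    exact lift_mk_le_lift_mk_of_injective (f := fun x => φ (x, 0))
      fun x y h => congrArg Prod.fst (hφ h)

end DenseSubspace

/-! ### Encoding `L^p` by classes of sets of finite measure. -/

section Cardinality

variable {Ω 𝕂 : Type*} [MeasurableSpace Ω] [RCLike 𝕂] {μ : Measure Ω} {p : ℝ≥0∞}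

theorem measure_preimage_inter_norm_ge_lt_top (hp : p ≠ 0) (hp' : p ≠ ∞) (f : Lp 𝕂 p μ)
    (U : Set 𝕂) (k : ℕ) : μ {x | f x ∈ U ∧ 1 / ((k : ℝ) + 1) ≤ ‖f x‖} < ∞ := by
  have hk : (1 / ((k : NNReal) + 1)) ≠ 0 := by positivity
  refine (measure_mono fun x hx => ?_).trans_lt ((Lp.memLp f).meas_ge_lt_top hp hp' hk)
  rw [Set.mem_ofPred_eq, ← NNReal.coe_le_coe]
  simpa using hx.2

/-- An element of `L^p` is encoded by the countably many sets of finite measure on which it takes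
values in a given basic open set and is bounded below by a given positive number. -/
def levelClasses (hp : p ≠ 0) (hp' : p ≠ ∞) (f : Lp 𝕂 p μ)
    (i : TopologicalSpace.countableBasis 𝕂 × ℕ) : Quotient (finSetsSetoid μ) :=
  Quotient.mk (finSetsSetoid μ) ⟨{x | f x ∈ i.1.1 ∧ 1 / ((i.2 : ℝ) + 1) ≤ ‖f x‖},
    ((Lp.stronglyMeasurable f).measurable
      (TopologicalSpace.isOpen_of_mem_countableBasis i.1.2).measurableSet).inter
      (measurableSet_le measurable_const (Lp.stronglyMeasurable f).norm.measurable),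
    measure_preimage_inter_norm_ge_lt_top hp hp' f _ _⟩

/-- If two values differ, one is nonzero, and a basic open set with a lower bound on the norm
contains it but not the other. Countably many such tests allow a common null set. -/
theorem levelClasses_injective (hp : p ≠ 0) (hp' : p ≠ ∞) :
    Function.Injective (levelClasses (𝕂 := 𝕂) (μ := μ) hp hp') := by
  intro f g h
  have key : ∀ i : TopologicalSpace.countableBasis 𝕂 × ℕ, ∀ᵐ x ∂μ,
      (f x ∈ i.1.1 ∧ 1 / ((i.2 : ℝ) + 1) ≤ ‖f x‖) ↔
        (g x ∈ i.1.1 ∧ 1 / ((i.2 : ℝ) + 1) ≤ ‖g x‖) := by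
    intro i
    have hi : μ _ = 0 := Quotient.exact (congrFun h i)
    filter_upwards [measure_eq_zero_iff_ae_notMem.1 hi] with x hx
    simp only [Set.mem_union, Set.mem_sdiff, Set.mem_ofPred_eq] at hx
    tauto
  have sep : ∀ a b : 𝕂, (∀ i : TopologicalSpace.countableBasis 𝕂 × ℕ,
      (a ∈ i.1.1 ∧ 1 / ((i.2 : ℝ) + 1) ≤ ‖a‖) → b ∈ i.1.1) → a ≠ 0 → a = b := by
    intro a b hab ha
    by_contra hne
    obtain ⟨U, hU, haU, hUb⟩ := (TopologicalSpace.isBasis_countableBasis 𝕂).exists_subset_of_mem_open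
      (show a ∈ ({b}ᶜ : Set 𝕂) from hne) isOpen_compl_singleton
    obtain ⟨k, hk⟩ := exists_nat_one_div_lt (norm_pos_iff.2 ha)
    exact hUb (hab (⟨U, hU⟩, k) ⟨haU, hk.le⟩) rfl
  refine Lp.ext ?_
  filter_upwards [ae_all_iff.2 key] with x hx
  by_cases hf : f x = 0
  · by_cases hg : g x = 0
    · rw [hf, hg]
    · exact (sep _ _ (fun i hi => ((hx i).2 hi).1) hg).symm
  · exact sep _ _ (fun i hi => ((hx i).1 hi).1) hf

/-- If the classes of sets of finite measure can be encoded by sequences in `A`, so can the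
elements of `L^p`. -/
theorem exists_injective_prod_nat (hp : p ≠ 0) (hp' : p ≠ ∞) {A : Type*} [Nontrivial A]
    (e : Quotient (finSetsSetoid μ) → (ℕ → A)) (he : Function.Injective e) :
    ∃ φ : Lp 𝕂 p μ × ℕ → (ℕ → A), Function.Injective φ := by
  obtain ⟨a, b, hab⟩ := exists_pair_ne A
  obtain ⟨enc, henc⟩ := exists_injective_nat (((TopologicalSpace.countableBasis 𝕂 × ℕ) × ℕ) ⊕ ℕ)
  -- The second summand records the natural number as the position of the only `a` among copies of
  -- `b`.
  let Φ : Lp 𝕂 p μ × ℕ → (((TopologicalSpace.countableBasis 𝕂 × ℕ) × ℕ) ⊕ ℕ → A) := fun x =>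
    Sum.elim (fun i => e (levelClasses hp hp' x.1 i.1) i.2) (fun n => if n = x.2 then a else b)
  have hΦ : Function.Injective Φ := by
    rintro ⟨f, m⟩ ⟨g, n⟩ h
    have h1 : f = g := levelClasses_injective hp hp' (funext fun i => he (funext fun j =>
      congrFun h (Sum.inl (i, j))))
    have h2 : m = n := by
      have := congrFun h (Sum.inr m)
      by_contra hne
      simp [Φ, hne, hab] at this
    rw [h1, h2]
  refine ⟨fun x => Function.extend enc (Φ x) fun _ => a, fun x y hxy => hΦ (funext fun i => ?_)⟩
  have := congrFun hxy (enc i)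
  simpa only [henc.extend_apply] using this

end Cardinality

/-! ### Growth of the contribution of a node to the `L^q` norm. -/

section Growth

theorem eventually_lt_two_rpow {d : ℝ} (hd : 0 < d) (e : ℝ) {C : ℝ≥0∞} (hC : C ≠ ∞) :
    ∀ᶠ n : ℕ in Filter.atTop, C < 2 ^ ((n : ℝ) ^ 2 * d - n * e) := by
  have h1 : ∀ᶠ n : ℕ in Filter.atTop, C < (2 : ℝ≥0∞) ^ n :=
    (ENNReal.tendsto_pow_atTop_nhds_top_iff.2 ENNReal.one_lt_two).eventually
      (lt_mem_nhds hC.lt_top)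
  have h2 : ∀ᶠ n : ℕ in Filter.atTop, (1 + e) / d ≤ n :=
    tendsto_natCast_atTop_atTop.eventually_ge_atTop _
  filter_upwards [h1, h2] with n hn1 hn2
  refine hn1.trans_le ?_
  rw [← ENNReal.rpow_natCast]
  refine ENNReal.rpow_le_rpow_of_exponent_le ENNReal.one_lt_two.le ?_
  rw [div_le_iff₀ hd] at hn2
  nlinarith [mul_le_mul_of_nonneg_left hn2 (Nat.cast_nonneg (α := ℝ) n)]

/-- With `r = 1 / p` and `s = 1 / q`, the left side is the `L^q` norm over a node of measure `m` at
level `n`. The loss `2 ^ (-n r)` is beaten by `m ^ (s - r)` when `m` is quadratically small or large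
in the exponent. -/
theorem two_pow_mul_rpow_neg_mul_rpow {m : ℝ≥0∞} (h0 : m ≠ 0) (h1 : m ≠ ∞) (n : ℕ) (r s : ℝ) :
    (2 ^ n * m) ^ (-r) * m ^ s = 2 ^ (-(n * r)) * m ^ (s - r) := by
  rw [ENNReal.mul_rpow_of_ne_top (by simp) h1, mul_assoc, ← ENNReal.rpow_add _ _ h0 h1,
    ← ENNReal.rpow_natCast, ← ENNReal.rpow_mul]
  ring_nf

theorem two_rpow_le_of_le_inv {m : ℝ≥0∞} (h0 : m ≠ 0) (h1 : m ≠ ∞) {n : ℕ}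
    (hm : m ≤ (2 ^ (n ^ 2))⁻¹) {r s : ℝ} (hsr : s < r) :
    2 ^ ((n : ℝ) ^ 2 * (r - s) - n * r) ≤ (2 ^ n * m) ^ (-r) * m ^ s := by
  rw [two_pow_mul_rpow_neg_mul_rpow h0 h1, sub_eq_neg_add, ENNReal.rpow_add _ _ (by simp) (by simp)]
  gcongr
  rw [ENNReal.rpow_mul, ← neg_sub r s, ENNReal.rpow_neg, ← ENNReal.inv_rpow]
  refine ENNReal.rpow_le_rpow ?_ (sub_pos.2 hsr).le
  rw [ENNReal.le_inv_iff_le_inv]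
  exact_mod_cast hm

theorem two_rpow_le_of_le {m : ℝ≥0∞} (h0 : m ≠ 0) (h1 : m ≠ ∞) {n : ℕ}
    (hm : 2 ^ (n ^ 2) ≤ m) {r s : ℝ} (hrs : r < s) :
    2 ^ ((n : ℝ) ^ 2 * (s - r) - n * r) ≤ (2 ^ n * m) ^ (-r) * m ^ s := by
  rw [two_pow_mul_rpow_neg_mul_rpow h0 h1, sub_eq_neg_add, ENNReal.rpow_add _ _ (by simp) (by simp)]
  gcongr
  rw [ENNReal.rpow_mul]
  refine ENNReal.rpow_le_rpow ?_ (sub_pos.2 hrs).le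
  exact_mod_cast hm

end Growth

/-! ### Functions attached to the branches of a tree. -/

section Tree

theorem enorm_ofReal_toReal {𝕂 : Type*} [RCLike 𝕂] (y : ℝ≥0∞) :
    ‖(y.toReal : 𝕂)‖ₑ = ENNReal.ofReal y.toReal := by
  rw [← ofReal_norm, RCLike.norm_ofReal, abs_of_nonneg ENNReal.toReal_nonneg]

variable {Ω 𝕂 : Type*} [MeasurableSpace Ω] [RCLike 𝕂] {μ : Measure Ω} {p : ℝ≥0∞} {A : Type*}

/-- The node of length `n` on the branch `b` of the tree of finite sequences in `A`. -/
def node (b : ℕ → A) (n : ℕ) : List A := (List.range n).map b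

@[simp] theorem length_node (b : ℕ → A) (n : ℕ) : (node b n).length = n := by simp [node]

theorem node_eq_node_iff {b b' : ℕ → A} {n : ℕ} : node b n = node b' n ↔ ∀ k < n, b k = b' k := by
  simp [node]

theorem eventually_node_ne {b b' : ℕ → A} (h : b ≠ b') :
    ∀ᶠ n in Filter.atTop, node b n ≠ node b' n := by
  obtain ⟨k, hk⟩ := Function.ne_iff.1 h
  filter_upwards [Filter.eventually_gt_atTop k] with n hn he
  exact hk (node_eq_node_iff.1 he k hn)

/-- A family of measurable sets of positive finite measure, with null pairwise intersections,
indexed by the tree of finite sequences in `A`. -/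
structure IsTreeFamily (μ : Measure Ω) (D : List A → Set Ω) : Prop where
  measurableSet : ∀ s, MeasurableSet (D s)
  ne_zero : ∀ s, μ (D s) ≠ 0
  ne_top : ∀ s, μ (D s) ≠ ∞
  inter_null : ∀ s t, s ≠ t → μ (D s ∩ D t) = 0

/-- The value at the node `s` that makes the contribution of `D s` to `∫ |f|^p` equal to
`2 ^ (-length s)`. -/
def weight (p : ℝ≥0∞) (μ : Measure Ω) (D : List A → Set Ω) (s : List A) : ℝ≥0∞ :=
  (2 ^ s.length * μ (D s)) ^ (-(1 / p.toReal))

/-- The sum of the weighted indicators of the sets attached to the nodes of a branch. -/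
def branchSum (p : ℝ≥0∞) (μ : Measure Ω) (D : List A → Set Ω) (b : ℕ → A) (x : Ω) : ℝ≥0∞ :=
  ∑' n, (D (node b n)).indicator (fun _ => weight p μ D (node b n)) x

/-- The scalar-valued version of `branchSum`. -/
def branchFun (𝕂 : Type*) [RCLike 𝕂] (p : ℝ≥0∞) (μ : Measure Ω) (D : List A → Set Ω)
    (b : ℕ → A) (x : Ω) : 𝕂 :=
  ((branchSum p μ D b x).toReal : 𝕂)

namespace IsTreeFamily

variable {D : List A → Set Ω} (hD : IsTreeFamily μ D)
include hD

theorem weight_ne_top (s : List A) : weight p μ D s ≠ ∞ := by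
  have := hD.ne_zero s
  have := hD.ne_top s
  have h1 : (2 ^ s.length * μ (D s)) ≠ 0 := by simp_all
  have h2 : (2 ^ s.length * μ (D s)) ≠ ∞ := ENNReal.mul_ne_top (by simp) (by assumption)
  exact ENNReal.rpow_ne_top_of_ne_zero h1 h2

theorem weight_rpow_mul (hp : p ≠ 0) (hp' : p ≠ ∞) (s : List A) :
    weight p μ D s ^ p.toReal * μ (D s) = (2 ^ s.length)⁻¹ := by
  have ht : p.toReal ≠ 0 := (ENNReal.toReal_pos hp hp').ne'
  rw [weight, ← ENNReal.rpow_mul, neg_mul, one_div_mul_cancel ht, ENNReal.rpow_neg_one,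
    ENNReal.mul_inv (Or.inl (by simp)) (Or.inl (by simp)), mul_assoc,
    ENNReal.inv_mul_cancel (hD.ne_zero s) (hD.ne_top s), mul_one]

-- Almost every point of `D s` lies in no other node set, and the length of `s` is the only index at
-- which the branch can pass through `s`.
open Classical in
theorem branchSum_ae (b : ℕ → A) (s : List A) :
    ∀ᵐ x ∂μ, x ∈ D s →
      branchSum p μ D b x = if node b s.length = s then weight p μ D s else 0 := by
  have h : ∀ n, ∀ᵐ x ∂μ, node b n ≠ s → x ∉ D (node b n) ∩ D s := by
    intro n
    by_cases hn : node b n = s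
    · exact Filter.Eventually.of_forall fun x hx => absurd hn hx
    · filter_upwards [measure_eq_zero_iff_ae_notMem.1 (hD.inter_null _ _ hn)] with x hx _ using hx
  filter_upwards [ae_all_iff.2 h] with x hx hxs
  rw [branchSum, tsum_eq_single s.length]
  · split_ifs with hs
    · rw [hs, Set.indicator_of_mem hxs]
    · exact Set.indicator_of_notMem (fun hm => hx _ hs ⟨hm, hxs⟩) _
  · intro n hn
    have hne : node b n ≠ s := by
      rintro rfl
      exact hn (length_node b n).symm
    exact Set.indicator_of_notMem (fun hm => hx _ hne ⟨hm, hxs⟩) _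

open Classical in
theorem branchFun_ae (b : ℕ → A) (s : List A) :
    ∀ᵐ x ∂μ, x ∈ D s →
      branchFun 𝕂 p μ D b x =
        if node b s.length = s then ((weight p μ D s).toReal : 𝕂) else 0 := by
  filter_upwards [hD.branchSum_ae (p := p) b s] with x hx hxs
  rw [branchFun, hx hxs]
  split_ifs <;> simp

theorem measurable_branchSum (b : ℕ → A) : Measurable (branchSum p μ D b) :=
  Measurable.tsum fun _ => measurable_const.indicator (hD.measurableSet _)

/-- Almost everywhere at most one summand is nonzero, so the power passes inside the sum. -/
theorem branchSum_rpow_ae (hp : p ≠ 0) (hp' : p ≠ ∞) (b : ℕ → A) :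
    ∀ᵐ x ∂μ, branchSum p μ D b x ^ p.toReal ≤
      ∑' n, (D (node b n)).indicator (fun _ => weight p μ D (node b n) ^ p.toReal) x := by
  have ht : 0 < p.toReal := ENNReal.toReal_pos hp hp'
  filter_upwards [ae_all_iff.2 fun n => hD.branchSum_ae (p := p) b (node b n)] with x hx
  by_cases h : ∃ n, x ∈ D (node b n)
  · obtain ⟨n, hn⟩ := h
    rw [hx n hn, length_node, if_pos rfl]
    refine le_trans (le_of_eq ?_) (ENNReal.le_tsum n)
    rw [Set.indicator_of_mem hn]
  · have : branchSum p μ D b x = 0 := by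
      rw [branchSum, ENNReal.tsum_eq_zero]
      exact fun n => Set.indicator_of_notMem (fun hn => h ⟨n, hn⟩) _
    rw [this, ENNReal.zero_rpow_of_pos ht]
    exact zero_le

theorem memLp_branchFun (hp : p ≠ 0) (hp' : p ≠ ∞) (b : ℕ → A) :
    MemLp (branchFun 𝕂 p μ D b) p μ := by
  have ht : 0 < p.toReal := ENNReal.toReal_pos hp hp'
  refine ⟨(RCLike.measurable_ofReal.comp
    (hD.measurable_branchSum b).ennreal_toReal).aestronglyMeasurable, ?_⟩
  rw [eLpNorm_lt_top_iff_lintegral_rpow_enorm_lt_top hp hp']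
  calc ∫⁻ x, ‖branchFun 𝕂 p μ D b x‖ₑ ^ p.toReal ∂μ
      ≤ ∫⁻ x, ∑' n, (D (node b n)).indicator
          (fun _ => weight p μ D (node b n) ^ p.toReal) x ∂μ := by
        refine lintegral_mono_ae ?_
        filter_upwards [hD.branchSum_rpow_ae hp hp' b] with x hx
        refine (ENNReal.rpow_le_rpow ?_ ht.le).trans hx
        rw [branchFun, enorm_ofReal_toReal]
        exact ENNReal.ofReal_toReal_le
    _ = ∑' n : ℕ, (2⁻¹ : ℝ≥0∞) ^ n := by
        rw [lintegral_tsum fun n =>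
          (measurable_const.indicator (hD.measurableSet _)).aemeasurable]
        refine tsum_congr fun n => ?_
        rw [lintegral_indicator_const (hD.measurableSet _), hD.weight_rpow_mul hp hp',
          length_node, ENNReal.inv_pow]
    _ < ∞ := by
        rw [ENNReal.tsum_geometric]
        simp

open Classical in
theorem linearCombination_ae (hp : p ≠ 0) (hp' : p ≠ ∞) (s : List A) (l : (ℕ → A) →₀ 𝕂) :
    ∀ᵐ x ∂μ, x ∈ D s →
      Finsupp.linearCombination 𝕂 (fun b => (hD.memLp_branchFun (𝕂 := 𝕂) hp hp' b).toLp) l x =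
        Finsupp.linearCombination 𝕂
          (fun b => if node b s.length = s then ((weight p μ D s).toReal : 𝕂) else 0) l := by
  induction l using Finsupp.induction_linear with
  | zero =>
    filter_upwards [Lp.coeFn_zero 𝕂 p μ] with x hx _
    simpa using hx
  | add l₁ l₂ h₁ h₂ =>
    rw [map_add, map_add]
    filter_upwards [h₁, h₂, Lp.coeFn_add
      (Finsupp.linearCombination 𝕂 (fun b => (hD.memLp_branchFun (𝕂 := 𝕂) hp hp' b).toLp) l₁)
      (Finsupp.linearCombination 𝕂 (fun b => (hD.memLp_branchFun (𝕂 := 𝕂) hp hp' b).toLp) l₂)]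
      with x hx₁ hx₂ hx hxs
    rw [hx, Pi.add_apply, hx₁ hxs, hx₂ hxs]
  | single b c =>
    rw [Finsupp.linearCombination_single, Finsupp.linearCombination_single]
    filter_upwards [Lp.coeFn_smul c (hD.memLp_branchFun (𝕂 := 𝕂) hp hp' b).toLp,
      (hD.memLp_branchFun (𝕂 := 𝕂) hp hp' b).coeFn_toLp, hD.branchFun_ae (p := p) (𝕂 := 𝕂) b s]
      with x h1 h2 h3 hxs
    rw [h1, Pi.smul_apply, h2, h3 hxs]

/-- If the contributions of the nodes of each branch to the `L^q` norm are unbounded, the functions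
attached to the branches are linearly independent modulo `L^q`. -/
theorem linearIndependent_mkQ (hp : p ≠ 0) (hp' : p ≠ ∞) {q : ℝ≥0∞} (hq : q ≠ 0)
    (hgrow : ∀ b : ℕ → A, ∀ C : ℝ≥0∞, C ≠ ∞ → ∃ᶠ n in Filter.atTop,
      C < weight p μ D (node b n) * μ (D (node b n)) ^ (1 / q.toReal)) :
    LinearIndependent 𝕂 ((interLq 𝕂 p μ q).mkQ ∘
      fun b : ℕ → A => (hD.memLp_branchFun (𝕂 := 𝕂) hp hp' b).toLp) := by
  classical
  rw [linearIndependent_iff]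
  intro l hl
  by_contra hne
  obtain ⟨b, hb⟩ := Finsupp.ne_iff.1 hne
  rw [Finsupp.coe_zero, Pi.zero_apply] at hb
  rw [← Finsupp.apply_linearCombination, Submodule.mkQ_apply,
    Submodule.Quotient.mk_eq_zero, mem_interLq, Lp.mem_Lp_iff_eLpNorm_lt_top] at hl
  set F := Finsupp.linearCombination 𝕂
    (fun b => (hD.memLp_branchFun (𝕂 := 𝕂) hp hp' b).toLp) l with hF
  -- The support is finite, so from some level on `b` shares no node with the other branches, and on
  -- `D (node b n)` only the term of `b` survives.
  have hsep : ∀ᶠ n in Filter.atTop, ∀ b' ∈ l.support, b' ≠ b → node b' n ≠ node b n := by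
    refine (Filter.eventually_all_finset _).2 fun b' _ => ?_
    by_cases h : b' = b
    · exact Filter.Eventually.of_forall fun _ h' => absurd h h'
    · exact (eventually_node_ne h).mono fun _ h' _ => h'
  have hC : eLpNorm F q μ / ‖l b‖ₑ ≠ ∞ := ENNReal.div_ne_top hl.ne (by simpa using hb)
  obtain ⟨n, hn, hsn⟩ := ((hgrow b _ hC).and_eventually hsep).exists
  refine hn.not_ge ?_
  rw [ENNReal.le_div_iff_mul_le (Or.inl (by simpa using hb)) (Or.inl (by simp))]
  set s := node b n with hs
  have hval : Finsupp.linearCombination 𝕂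
      (fun b => if node b s.length = s then ((weight p μ D s).toReal : 𝕂) else 0) l =
      l b * ((weight p μ D s).toReal : 𝕂) := by
    rw [Finsupp.linearCombination_apply, Finsupp.sum, Finset.sum_eq_single b]
    · rw [hs, length_node, if_pos rfl, smul_eq_mul]
    · intro b' hb' hne'
      rw [hs, length_node, if_neg (hsn b' hb' hne'), smul_zero]
    · intro h
      rw [Finsupp.notMem_support_iff.1 h, zero_smul]
  calc weight p μ D s * μ (D s) ^ (1 / q.toReal) * ‖l b‖ₑ
      = ‖l b * ((weight p μ D s).toReal : 𝕂)‖ₑ * μ (D s) ^ (1 / q.toReal) := by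
        rw [enorm_mul, enorm_ofReal_toReal,
          ENNReal.ofReal_toReal (hD.weight_ne_top s)]
        ring
    _ = eLpNorm ((D s).indicator fun _ => l b * ((weight p μ D s).toReal : 𝕂)) q μ :=
        (eLpNorm_indicator_const' (hD.measurableSet s) (hD.ne_zero s) hq).symm
    _ ≤ eLpNorm F q μ := by
        refine eLpNorm_mono_enorm_ae ?_
        filter_upwards [hD.linearCombination_ae (𝕂 := 𝕂) hp hp' s l] with x hx
        by_cases hxs : x ∈ D s
        · rw [Set.indicator_of_mem hxs, ← hval, ← hx hxs]
        · rw [Set.indicator_of_notMem hxs, enorm_zero]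
          exact zero_le

theorem linearIndependent_mkQ_of_lt (hp : p ≠ 0) (hp' : p ≠ ∞) {q : ℝ≥0∞} (hq : p < q)
    (hsmall : ∀ b : ℕ → A, ∃ᶠ n in Filter.atTop, μ (D (node b n)) ≤ (2 ^ (n ^ 2))⁻¹) :
    LinearIndependent 𝕂 ((interLq 𝕂 p μ q).mkQ ∘
      fun b : ℕ → A => (hD.memLp_branchFun (𝕂 := 𝕂) hp hp' b).toLp) := by
  have hp0 : 0 < p.toReal := ENNReal.toReal_pos hp hp'
  have hlt : 1 / q.toReal < 1 / p.toReal := by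
    -- For `q = ∞` the conventions `∞.toReal = 0` and `1 / 0 = 0` give the correct exponent `0`.
    by_cases hq' : q = ∞
    · simpa [hq'] using hp0
    · exact one_div_lt_one_div_of_lt hp0 ((ENNReal.toReal_lt_toReal hp' hq').2 hq)
  refine hD.linearIndependent_mkQ hp hp' (pos_of_gt hq).ne' fun b C hC => ?_
  refine ((hsmall b).and_eventually
    (eventually_lt_two_rpow (sub_pos.2 hlt) (1 / p.toReal) hC)).mono fun n hn => ?_
  refine hn.2.trans_le ((two_rpow_le_of_le_inv (hD.ne_zero _) (hD.ne_top _) hn.1 hlt).trans_eq ?_)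
  rw [weight, length_node]

theorem linearIndependent_mkQ_of_gt (hp : p ≠ 0) (hp' : p ≠ ∞) {q : ℝ≥0∞} (hq0 : 0 < q)
    (hq : q < p)
    (hlarge : ∀ b : ℕ → A, ∃ᶠ n in Filter.atTop, 2 ^ (n ^ 2) ≤ μ (D (node b n))) :
    LinearIndependent 𝕂 ((interLq 𝕂 p μ q).mkQ ∘
      fun b : ℕ → A => (hD.memLp_branchFun (𝕂 := 𝕂) hp hp' b).toLp) := by
  have hq' : q ≠ ∞ := (hq.trans_le le_top).ne
  have hlt : 1 / p.toReal < 1 / q.toReal := one_div_lt_one_div_of_lt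
    (ENNReal.toReal_pos hq0.ne' hq') ((ENNReal.toReal_lt_toReal hq' hp').2 hq)
  refine hD.linearIndependent_mkQ hp hp' hq0.ne' fun b C hC => ?_
  refine ((hlarge b).and_eventually
    (eventually_lt_two_rpow (sub_pos.2 hlt) (1 / p.toReal) hC)).mono fun n hn => ?_
  refine hn.2.trans_le ((two_rpow_le_of_le (hD.ne_zero _) (hD.ne_top _) hn.1 hlt).trans_eq ?_)
  rw [weight, length_node]

end IsTreeFamily

end Tree

/-! ### Disjoint sets of small or large measure. -/

section DisjointSequences

variable {Ω : Type*} [MeasurableSpace Ω] {μ : Measure Ω}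

theorem CondAlphaOn.exists_subset_lt {S : Set Ω} (h : CondAlphaOn μ S) {ε : ℝ≥0∞} (hε : ε ≠ 0) :
    ∃ C, MeasurableSet C ∧ C ⊆ S ∧ μ C ≠ 0 ∧ μ C < ε := by
  have : sInf _ < ε := h.trans_lt hε.bot_lt
  obtain ⟨_, ⟨C, hC, hCS, h0, rfl⟩, hlt⟩ := sInf_lt_iff.1 this
  exact ⟨C, hC, hCS, h0.ne', hlt⟩

theorem CondAlpha.condAlphaOn_univ (h : CondAlpha μ) : CondAlphaOn μ Set.univ := by
  simpa [CondAlphaOn, CondAlpha] using h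

theorem CondBeta.exists_lt (h : CondBeta μ) {C : ℝ≥0∞} (hC : C ≠ ∞) :
    ∃ S, MeasurableSet S ∧ μ S ≠ ∞ ∧ C < μ S := by
  have : C < sSup _ := hC.lt_top.trans_eq h.symm
  obtain ⟨_, ⟨S, hS, hf, rfl⟩, hlt⟩ := lt_sSup_iff.1 this
  exact ⟨S, hS, hf.ne, hlt⟩

theorem tsum_inv_three_pow_succ_lt_one : ∑' j : ℕ, (3⁻¹ : ℝ≥0∞) ^ (j + 1) < 1 := by
  simp_rw [pow_succ']
  rw [ENNReal.tsum_mul_left, ENNReal.tsum_geometric, ← ENNReal.mul_inv (by simp) (by simp),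
    ENNReal.inv_lt_one, ENNReal.mul_sub (by simp), ENNReal.mul_inv_cancel (by simp) (by simp)]
  rw [mul_one, lt_tsub_iff_right]
  norm_num

/-- Under `[α]`, there are pairwise disjoint sets of positive and arbitrarily small measure. -/
theorem CondAlpha.exists_disjoint_le (h : CondAlpha μ) (w : ℕ → ℝ≥0∞) (hw : ∀ k, w k ≠ 0) :
    ∃ C : ℕ → Set Ω, (∀ k, MeasurableSet (C k)) ∧ (∀ k, μ (C k) ≠ 0) ∧ (∀ k, μ (C k) ≤ w k) ∧
      μ (⋃ k, C k) ≠ ∞ ∧ Pairwise (Function.onFun Disjoint C) := by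
  choose! T hT _ hT0 hTlt using fun (ε : ℝ≥0∞) (hε : ε ≠ 0) =>
    h.condAlphaOn_univ.exists_subset_lt hε
  -- The ratio `1 / 3` makes the later sets weigh at most half of `S n` in total, so removing them
  -- leaves positive measure.
  let S : ℕ → Set Ω := fun n => Nat.rec (T (min (w 0) 1))
    (fun k P => T (min (w (k + 1)) (3⁻¹ * μ P))) n
  have hS : ∀ n, MeasurableSet (S n) ∧ μ (S n) ≠ 0 ∧ μ (S n) ≤ w n := by
    intro n
    induction n with
    | zero =>
      have h0 : min (w 0) 1 ≠ 0 := by simp [min_eq_iff, hw 0]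
      exact ⟨hT _ h0, hT0 _ h0, (hTlt _ h0).le.trans (min_le_left _ _)⟩
    | succ k ih =>
      have h0 : min (w (k + 1)) (3⁻¹ * μ (S k)) ≠ 0 := by
        rw [ne_eq, ← nonpos_iff_eq_zero, min_le_iff, nonpos_iff_eq_zero, nonpos_iff_eq_zero]
        simp [hw, ih.2.1]
      exact ⟨hT _ h0, hT0 _ h0, (hTlt _ h0).le.trans (min_le_left _ _)⟩
  have hstep : ∀ n, μ (S (n + 1)) ≤ 3⁻¹ * μ (S n) := by
    intro n
    have h0 : min (w (n + 1)) (3⁻¹ * μ (S n)) ≠ 0 := by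
      rw [ne_eq, ← nonpos_iff_eq_zero, min_le_iff, nonpos_iff_eq_zero, nonpos_iff_eq_zero]
      simp [hw, (hS n).2.1]
    exact (hTlt _ h0).le.trans (min_le_right _ _)
  have hpow : ∀ n j, μ (S (n + j)) ≤ 3⁻¹ ^ j * μ (S n) := by
    intro n j
    induction j with
    | zero => simp
    | succ j ih =>
      calc μ (S (n + (j + 1))) ≤ 3⁻¹ * μ (S (n + j)) := hstep (n + j)
        _ ≤ 3⁻¹ * (3⁻¹ ^ j * μ (S n)) := by gcongr
        _ = 3⁻¹ ^ (j + 1) * μ (S n) := by rw [pow_succ', mul_assoc]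
  have h0top : μ (S 0) ≠ ∞ := by
    have h0 : min (w 0) 1 ≠ 0 := by simp [min_eq_iff, hw 0]
    exact ((hTlt _ h0).trans_le ((min_le_right _ _).trans le_top)).ne
  have htop : ∀ n, μ (S n) ≠ ∞ := by
    intro n
    have := hpow 0 n
    rw [zero_add] at this
    exact (this.trans_lt (ENNReal.mul_lt_top (by simp) h0top.lt_top)).ne
  have htail : ∀ n, μ (⋃ j, S (n + (j + 1))) < μ (S n) := by
    intro n
    calc μ (⋃ j, S (n + (j + 1))) ≤ ∑' j, μ (S (n + (j + 1))) := measure_iUnion_le _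
      _ ≤ ∑' j, 3⁻¹ ^ (j + 1) * μ (S n) := ENNReal.tsum_le_tsum fun j => hpow n (j + 1)
      _ = (∑' j : ℕ, (3⁻¹ : ℝ≥0∞) ^ (j + 1)) * μ (S n) := ENNReal.tsum_mul_right
      _ < 1 * μ (S n) :=
        ENNReal.mul_lt_mul_left (hS n).2.1 (htop n) tsum_inv_three_pow_succ_lt_one
      _ = μ (S n) := one_mul _
  refine ⟨fun n => S n \ ⋃ j, S (n + (j + 1)), fun n => (hS n).1.diff
    (MeasurableSet.iUnion fun j => (hS (n + (j + 1))).1), fun n => ?_,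
    fun n => (measure_mono Set.sdiff_subset).trans (hS n).2.2, ?_, ?_⟩
  · exact ((tsub_pos_of_lt (htail n)).trans_le le_measure_sdiff).ne'
  · have hsub : (⋃ n, S n \ ⋃ j, S (n + (j + 1))) ⊆ S 0 ∪ ⋃ j, S (0 + (j + 1)) := by
      refine Set.iUnion_subset fun n => Set.sdiff_subset.trans ?_
      cases n with
      | zero => exact Set.subset_union_left
      | succ j =>
        refine Set.Subset.trans ?_ Set.subset_union_right
        refine Set.subset_iUnion_of_subset j ?_
        rw [zero_add]
    refine ((measure_mono hsub).trans_lt ((measure_union_le _ _).trans_lt ?_)).ne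
    exact ENNReal.add_lt_top.2 ⟨h0top.lt_top, (htail 0).trans h0top.lt_top⟩
  · refine (pairwise_disjoint_on _).2 fun m n hmn => ?_
    obtain ⟨j, rfl⟩ := Nat.exists_eq_add_of_lt hmn
    exact Set.disjoint_sdiff_left.mono_right
      (Set.sdiff_subset.trans (Set.subset_iUnion (fun j => S (m + (j + 1))) j))

/-- Under `[β]`, there are pairwise disjoint sets of finite and arbitrarily large measure, which can
be chosen outside a given set of finite measure. -/
theorem CondBeta.exists_disjoint_ge (h : CondBeta μ) (w : ℕ → ℝ≥0∞) (hw : ∀ k, w k ≠ ∞)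
    {B : Set Ω} (hB : MeasurableSet B) (hBtop : μ B ≠ ∞) :
    ∃ E : ℕ → Set Ω, (∀ k, MeasurableSet (E k)) ∧ (∀ k, μ (E k) ≠ ∞) ∧ (∀ k, w k ≤ μ (E k)) ∧
      (∀ k, Disjoint B (E k)) ∧ Pairwise (Function.onFun Disjoint E) := by
  choose! T hT hTtop hTlt using fun (C : ℝ≥0∞) (hC : C ≠ ∞) => h.exists_lt hC
  -- The new set exceeds `w k + μ P` in measure, so it keeps at least `w k` after everything used
  -- before is removed.
  let P : ℕ → Set Ω := fun n => Nat.rec B (fun k P => P ∪ T (w k + μ P)) n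
  have hP : ∀ n, MeasurableSet (P n) ∧ μ (P n) ≠ ∞ := by
    intro n
    induction n with
    | zero => exact ⟨hB, hBtop⟩
    | succ k ih =>
      have h0 : w k + μ (P k) ≠ ∞ := ENNReal.add_ne_top.2 ⟨hw k, ih.2⟩
      exact ⟨ih.1.union (hT _ h0), measure_union_ne_top ih.2 (hTtop _ h0)⟩
  have h0 : ∀ k, w k + μ (P k) ≠ ∞ := fun k => ENNReal.add_ne_top.2 ⟨hw k, (hP k).2⟩
  have hmono : Monotone P := monotone_nat_of_le_succ fun n => Set.subset_union_left
  refine ⟨fun k => T (w k + μ (P k)) \ P k, fun k => (hT _ (h0 k)).diff (hP k).1,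
    fun k => ((measure_mono Set.sdiff_subset).trans_lt (hTtop _ (h0 k)).lt_top).ne, fun k => ?_,
    fun k => ?_, ?_⟩
  · refine le_trans ?_ le_measure_sdiff
    exact ENNReal.le_sub_of_add_le_right (hP k).2 (hTlt _ (h0 k)).le
  · exact Set.disjoint_sdiff_right.mono_left (hmono (Nat.zero_le k))
  · refine (pairwise_disjoint_on _).2 fun m n hmn => ?_
    refine Set.disjoint_sdiff_right.mono_left (Set.sdiff_subset.trans ?_)
    exact Set.subset_union_right.trans (hmono (Nat.succ_le_of_lt hmn))

end DisjointSequences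

/-! ### Large sets from a `μ`-disjoint family. -/

section Families

variable {Ω : Type*} [MeasurableSpace Ω] {μ : Measure Ω}

/-- If infinitely many sets of positive finite measure are `μ`-disjoint and as numerous as the
classes of sets of finite measure, then as many of them have measure at least `2 ^ (-k)`, for some
`k`: otherwise each sequence of such sets with small measures would have a union of finite
measure, and there would be too many such unions. -/
theorem MuDisjoint.exists_mk_le_inv_two_pow_le {F : Set (Set Ω)} (hF : MuDisjoint μ F)
    (hcard : #F = ent μ) (hinf : ℵ₀ ≤ #F) :
    ∃ k : ℕ, #F ≤ #{S : F | (2 ^ k)⁻¹ ≤ μ S.1} := by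
  by_contra! hlt
  have hinf' : Infinite F := infinite_iff.2 hinf
  let L : ℕ → Set F := fun k => {S : F | (2 ^ k)⁻¹ ≤ μ S.1}
  have hcover : #F ≤ Cardinal.sum fun k => #(L k) := by
    have : (Set.univ : Set F) ⊆ ⋃ k, L k := by
      intro S _
      obtain ⟨k, hk⟩ := ENNReal.exists_inv_two_pow_lt (hF.1 S.1 S.2).2.ne'
      refine Set.mem_iUnion.2 ⟨k, ?_⟩
      rw [← ENNReal.inv_pow] at hk
      exact hk.le
    calc #F = #(Set.univ : Set F) := mk_univ.symm
      _ ≤ #(⋃ k, L k) := mk_le_mk_of_subset this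
      _ ≤ Cardinal.sum fun k => #(L k) := by
        simpa using mk_iUnion_le_sum_mk_lift (f := L)
  -- König's inequality: a countable sum of cardinals below `#F` is less than the product of copies
  -- of `#F`.
  have hkonig : #F < #(ℕ → F) := by
    refine hcover.trans_lt ((Cardinal.sum_lt_prod _ _ hlt).trans_eq ?_)
    simp
  obtain ⟨e⟩ : Nonempty (F × ℕ ≃ F) := by
    refine Cardinal.eq.1 ?_
    simp [hinf]
  -- `F × ℕ ≃ F` splits `F` into rows of full size; fewer than `#F` sets of row `n` are large, so
  -- `#F` small ones remain.
  have hsmall : ∀ n : ℕ, ∃ j : F → F, Function.Injective j ∧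
      ∀ a, μ (e (j a, n)).1 ≤ 2⁻¹ ^ n := by
    intro n
    let K : Set F := {a | (2 ^ n)⁻¹ ≤ μ (e (a, n)).1}
    have hK : #K < #F := by
      refine lt_of_le_of_lt ?_ (hlt n)
      refine mk_le_of_injective
        (f := fun a : K => (⟨e (a.1, n), a.2⟩ : {S : F | (2 ^ n)⁻¹ ≤ μ S.1})) ?_
      intro a b hab
      have := e.injective (congrArg Subtype.val hab)
      exact Subtype.ext (congrArg Prod.fst this)
    obtain ⟨j⟩ := Cardinal.eq.1 (mk_compl_of_infinite K hK)
    refine ⟨fun a => (j.symm a).1, fun a b h => j.symm.injective (Subtype.ext h), fun a => ?_⟩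
    have h1 : ¬(2 ^ n)⁻¹ ≤ μ (e ((j.symm a).1, n)).1 := (j.symm a).2
    rw [← ENNReal.inv_pow]
    exact (not_le.1 h1).le
  choose j hj hjle using hsmall
  have hmeas : ∀ x : ℕ → F, MeasurableSet (⋃ n, (e (j n (x n), n)).1) := fun x =>
    MeasurableSet.iUnion fun n => (hF.1 _ (e (j n (x n), n)).2).1
  have hfin : ∀ x : ℕ → F, μ (⋃ n, (e (j n (x n), n)).1) < ∞ := by
    intro x
    refine (measure_iUnion_le _).trans_lt
      ((ENNReal.tsum_le_tsum fun n => hjle n (x n)).trans_lt ?_)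
    rw [ENNReal.tsum_geometric]
    simp
  let Φ : (ℕ → F) → Quotient (finSetsSetoid μ) := fun x =>
    Quotient.mk (finSetsSetoid μ) ⟨_, hmeas x, hfin x⟩
  have hΦ : Function.Injective Φ := by
    intro x y hxy
    by_contra hne
    obtain ⟨n, hn⟩ := Function.ne_iff.1 hne
    have hnull : μ _ = 0 := Quotient.exact hxy
    set S := e (j n (x n), n) with hS
    -- Where the sequences differ, the set chosen by `x` is almost disjoint from the union for `y`;
    -- equal classes would make it null.
    have hinter : μ (S.1 ∩ ⋃ m, (e (j m (y m), m)).1) = 0 := by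
      rw [Set.inter_iUnion]
      refine measure_iUnion_null fun m => hF.2 _ S.2 _ (e (j m (y m), m)).2 fun h => ?_
      have h1 := e.injective (Subtype.ext h)
      obtain rfl : n = m := congrArg Prod.snd h1
      exact hn (hj n (congrArg Prod.fst h1))
    refine (hF.1 S.1 S.2).2.ne' (measure_mono_null ?_ (measure_union_null hnull hinter))
    intro z hz
    have hzx : z ∈ ⋃ m, (e (j m (x m), m)).1 := Set.mem_iUnion.2 ⟨n, hz⟩
    by_cases hzy : z ∈ ⋃ m, (e (j m (y m), m)).1
    · exact Or.inr ⟨hz, hzy⟩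
    · exact Or.inl (Or.inl ⟨hzx, hzy⟩)
  exact (hkonig.trans_le ((mk_le_of_injective hΦ).trans_eq hcard.symm)).false

/-- A subfamily of cardinality `#F` can be reindexed by `List F × ℕ`. -/
theorem exists_equiv_list_prod_nat {α : Type*} {G : Set α} (hinf : ℵ₀ ≤ #α) (hG : #α ≤ #G) :
    Nonempty (List α × ℕ ≃ G) := by
  have : Infinite α := infinite_iff.2 hinf
  have hG' : #G = #α := (mk_set_le G).antisymm hG
  refine Cardinal.eq.1 ?_
  rw [hG']
  simp [mk_list_eq_mk, hinf]

theorem measure_inter_null_of_subset_iUnion {B : Type*} {X : B × ℕ → Set Ω}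
    (hX : ∀ i j, i ≠ j → μ (X i ∩ X j) = 0) {D : B → Set Ω} (hD : ∀ s, D s ⊆ ⋃ j, X (s, j))
    (s t : B) (hst : s ≠ t) : μ (D s ∩ D t) = 0 := by
  refine measure_mono_null (Set.inter_subset_inter (hD s) (hD t)) ?_
  rw [Set.iUnion_inter_iUnion]
  exact measure_iUnion_null fun i => measure_iUnion_null fun j =>
    hX _ _ fun h => hst (congrArg Prod.fst h)

/-- Join `2 ^ m * 2 ^ k` of the sets, each of measure at least `2 ^ (-k)`. -/
theorem exists_finite_union_ge {X : ℕ → Set Ω} (hX : ∀ i, MeasurableSet (X i))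
    (hnull : ∀ i j, i ≠ j → μ (X i ∩ X j) = 0) (htop : ∀ i, μ (X i) ≠ ∞) {k : ℕ}
    (hk : ∀ i, (2 ^ k)⁻¹ ≤ μ (X i)) (m : ℕ) :
    ∃ E, MeasurableSet E ∧ E ⊆ ⋃ i, X i ∧ μ E ≠ ∞ ∧ 2 ^ m ≤ μ E := by
  refine ⟨⋃ i ∈ Finset.range (2 ^ m * 2 ^ k), X i, Finset.measurableSet_biUnion _ fun i _ => hX i,
    Set.iUnion₂_subset fun i _ => Set.subset_iUnion X i, ?_, ?_⟩
  · exact ((measure_biUnion_finset_le _ _).trans_lt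
      (ENNReal.sum_lt_top.2 fun i _ => (htop i).lt_top)).ne
  · rw [measure_biUnion_finset₀ (fun i _ j _ hij => hnull i j hij)
      fun i _ => (hX i).nullMeasurableSet]
    calc (2 : ℝ≥0∞) ^ m = ∑ i ∈ Finset.range (2 ^ m * 2 ^ k), (2 ^ k)⁻¹ := by
          rw [Finset.sum_const, Finset.card_range, nsmul_eq_mul]
          push_cast
          rw [mul_assoc, ENNReal.mul_inv_cancel (by simp) (by simp), mul_one]
      _ ≤ _ := Finset.sum_le_sum fun i _ => hk i

end Families

/-! ### From tree families to lineability. -/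

section Lineability

variable {Ω 𝕂 : Type*} [MeasurableSpace Ω] [RCLike 𝕂] {μ : Measure Ω} {p : ℝ≥0∞} {A : Type*}
  {D : List A → Set Ω}

theorem rStrict_eq_avoiding : rStrict 𝕂 p μ = avoiding 𝕂 p μ (Set.Ioi p) := rfl

theorem lStrict_eq_avoiding : lStrict 𝕂 p μ = avoiding 𝕂 p μ (Set.Ioo 0 p) := by
  ext f
  exact ⟨fun h q hq => h q hq.1 hq.2, fun h q h0 hq => h q ⟨h0, hq⟩⟩

theorem strict_eq_avoiding : strict 𝕂 p μ = avoiding 𝕂 p μ {q | 0 < q ∧ q ≠ p} := by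
  ext f
  exact ⟨fun h q hq => h q hq.1 hq.2, fun h q h0 hq => h q ⟨h0, hq⟩⟩

theorem IsTreeFamily.maximalDenseLineable_rStrict (hD : IsTreeFamily μ D) (hp : p ≠ 0)
    (hp' : p ≠ ∞)
    (hsmall : ∀ b : ℕ → A, ∃ᶠ n in Filter.atTop, μ (D (node b n)) ≤ (2 ^ (n ^ 2))⁻¹)
    (hφ : ∃ φ : Lp 𝕂 p μ × ℕ → (ℕ → A), Function.Injective φ) :
    MaximalDenseLineable 𝕂 (lpTopology 𝕂 p μ hp) (rStrict 𝕂 p μ) := by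
  obtain ⟨φ, hφ⟩ := hφ
  rw [rStrict_eq_avoiding]
  exact maximalDenseLineable_avoiding hp hp' ⟨∞, hp'.lt_top⟩ φ hφ _
    fun q hq => hD.linearIndependent_mkQ_of_lt hp hp' hq hsmall

theorem IsTreeFamily.maximalDenseLineable_lStrict (hD : IsTreeFamily μ D) (hp : p ≠ 0)
    (hp' : p ≠ ∞)
    (hlarge : ∀ b : ℕ → A, ∃ᶠ n in Filter.atTop, 2 ^ (n ^ 2) ≤ μ (D (node b n)))
    (hφ : ∃ φ : Lp 𝕂 p μ × ℕ → (ℕ → A), Function.Injective φ) :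
    MaximalDenseLineable 𝕂 (lpTopology 𝕂 p μ hp) (lStrict 𝕂 p μ) := by
  obtain ⟨φ, hφ⟩ := hφ
  rw [lStrict_eq_avoiding]
  exact maximalDenseLineable_avoiding hp hp'
    ⟨p / 2, ENNReal.half_pos hp, ENNReal.half_lt_self hp hp'⟩ φ hφ _
    fun q hq => hD.linearIndependent_mkQ_of_gt hp hp' hq.1 hq.2 hlarge

theorem IsTreeFamily.maximalDenseLineable_strict (hD : IsTreeFamily μ D) (hp : p ≠ 0)
    (hp' : p ≠ ∞)
    (hsmall : ∀ b : ℕ → A, ∃ᶠ n in Filter.atTop, μ (D (node b n)) ≤ (2 ^ (n ^ 2))⁻¹)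
    (hlarge : ∀ b : ℕ → A, ∃ᶠ n in Filter.atTop, 2 ^ (n ^ 2) ≤ μ (D (node b n)))
    (hφ : ∃ φ : Lp 𝕂 p μ × ℕ → (ℕ → A), Function.Injective φ) :
    MaximalDenseLineable 𝕂 (lpTopology 𝕂 p μ hp) (strict 𝕂 p μ) := by
  obtain ⟨φ, hφ⟩ := hφ
  rw [strict_eq_avoiding]
  refine maximalDenseLineable_avoiding hp hp' ⟨∞, by simp, hp'.symm⟩ φ hφ
    (fun b => (hD.memLp_branchFun hp hp' b).toLp) fun q hq => ?_
  rcases hq.2.lt_or_gt with h | h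
  · exact hD.linearIndependent_mkQ_of_gt hp hp' hq.1 h hlarge
  · exact hD.linearIndependent_mkQ_of_lt hp hp' h hsmall

theorem exists_injective_prod_nat_bool (hp : p ≠ 0) (hp' : p ≠ ∞) (h : ent μ ≤ 𝔠) :
    ∃ φ : Lp 𝕂 p μ × ℕ → (ℕ → Bool), Function.Injective φ := by
  obtain ⟨e⟩ : Nonempty (Quotient (finSetsSetoid μ) ↪ (ℕ → Bool)) := by
    rw [← Cardinal.lift_mk_le']
    simpa [ent] using h
  exact exists_injective_prod_nat hp hp' e e.injective

theorem exists_injective_prod_nat_of_mk_eq {F : Set (Set Ω)} (hp : p ≠ 0) (hp' : p ≠ ∞)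
    (hF : #F = ent μ) (hinf : ℵ₀ ≤ #F) :
    ∃ φ : Lp 𝕂 p μ × ℕ → (ℕ → F), Function.Injective φ := by
  have : Infinite F := infinite_iff.2 hinf
  obtain ⟨e⟩ := Cardinal.eq.1 hF.symm
  exact exists_injective_prod_nat hp hp' (fun c _ => e c)
    fun c d h => e.injective (congrFun h 0)

theorem frequently_even {P : ℕ → Prop} (h : ∀ n, Even n → P n) : ∃ᶠ n in Filter.atTop, P n :=
  Filter.frequently_atTop.2 fun n => ⟨2 * n, by lia, h _ (even_two_mul n)⟩

theorem frequently_not_even {P : ℕ → Prop} (h : ∀ n, ¬Even n → P n) :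
    ∃ᶠ n in Filter.atTop, P n :=
  Filter.frequently_atTop.2 fun n => ⟨2 * n + 1, by lia, h _ (by simp)⟩

end Lineability

theorem ne_zero_of_two_pow_le {m : ℝ≥0∞} {n : ℕ} (h : 2 ^ n ≤ m) : m ≠ 0 :=
  (lt_of_lt_of_le (ENNReal.pow_pos two_pos n) h).ne'

/-! ### Entropy at most the continuum: the binary tree. -/

section SmallEntropy

variable {Ω 𝕂 : Type*} [MeasurableSpace Ω] [RCLike 𝕂] {μ : Measure Ω} {p : ℝ≥0∞}

/-- The code of a list is at least its length, so a sequence indexed by codes meets the bounds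
required at each level. -/
theorem inv_two_pow_encode_le (s : List Bool) :
    ((2 : ℝ≥0∞) ^ (Encodable.encode s ^ 2))⁻¹ ≤ (2 ^ (s.length ^ 2))⁻¹ := by
  refine ENNReal.inv_le_inv.2 (pow_le_pow_right₀ ENNReal.one_lt_two.le ?_)
  exact Nat.pow_le_pow_left (Encodable.length_le_encode s) 2

theorem two_pow_le_two_pow_encode (s : List Bool) :
    (2 : ℝ≥0∞) ^ (s.length ^ 2) ≤ 2 ^ (Encodable.encode s ^ 2) :=
  pow_le_pow_right₀ ENNReal.one_lt_two.le
    (Nat.pow_le_pow_left (Encodable.length_le_encode s) 2)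

theorem isTreeFamily_encode {X : List Bool → ℕ → Set Ω} (hX : ∀ s k, MeasurableSet (X s k))
    (h0 : ∀ s k, μ (X s k) ≠ 0) (htop : ∀ s k, μ (X s k) ≠ ∞)
    (hdisj : ∀ s t k l, k ≠ l → Disjoint (X s k) (X t l)) :
    IsTreeFamily μ fun s => X s (Encodable.encode s) where
  measurableSet s := hX s _
  ne_zero s := h0 s _
  ne_top s := htop s _
  inter_null s t hst := by
    rw [(hdisj s t _ _ (Encodable.encode_injective.ne hst)).inter_eq, measure_empty]

theorem maximalDenseLineable_rStrict_of_condAlpha (hp : p ≠ 0) (hp' : p ≠ ∞) (hα : CondAlpha μ)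
    (hent : ent μ ≤ 𝔠) :
    MaximalDenseLineable 𝕂 (lpTopology 𝕂 p μ hp) (rStrict 𝕂 p μ) := by
  obtain ⟨C, hC, hC0, hCle, hCtop, hCd⟩ :=
    hα.exists_disjoint_le (fun k => (2 ^ (k ^ 2))⁻¹) (by simp)
  have hD : IsTreeFamily μ fun s : List Bool => C (Encodable.encode s) :=
    isTreeFamily_encode (X := fun _ => C) (fun _ => hC) (fun _ => hC0)
      (fun _ k => ((measure_mono (Set.subset_iUnion C k)).trans_lt hCtop.lt_top).ne)
      (fun _ _ _ _ h => hCd h)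
  refine hD.maximalDenseLineable_rStrict hp hp' (fun b => Filter.Frequently.of_forall fun n => ?_)
    (exists_injective_prod_nat_bool hp hp' hent)
  simpa using (hCle _).trans (inv_two_pow_encode_le (node b n))

theorem maximalDenseLineable_lStrict_of_condBeta (hp : p ≠ 0) (hp' : p ≠ ∞) (hβ : CondBeta μ)
    (hent : ent μ ≤ 𝔠) :
    MaximalDenseLineable 𝕂 (lpTopology 𝕂 p μ hp) (lStrict 𝕂 p μ) := by
  obtain ⟨E, hE, hEtop, hEle, -, hEd⟩ :=
    hβ.exists_disjoint_ge (fun k => 2 ^ (k ^ 2)) (by simp) MeasurableSet.empty (by simp)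
  have hD : IsTreeFamily μ fun s : List Bool => E (Encodable.encode s) :=
    isTreeFamily_encode (X := fun _ => E) (fun _ => hE)
      (fun _ k => ne_zero_of_two_pow_le (hEle k))
      (fun _ => hEtop) (fun _ _ _ _ h => hEd h)
  refine hD.maximalDenseLineable_lStrict hp hp' (fun b => Filter.Frequently.of_forall fun n => ?_)
    (exists_injective_prod_nat_bool hp hp' hent)
  simpa using (two_pow_le_two_pow_encode (node b n)).trans (hEle _)

theorem maximalDenseLineable_strict_of_condAlpha_of_condBeta (hp : p ≠ 0) (hp' : p ≠ ∞)
    (hα : CondAlpha μ) (hβ : CondBeta μ) (hent : ent μ ≤ 𝔠) :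
    MaximalDenseLineable 𝕂 (lpTopology 𝕂 p μ hp) (strict 𝕂 p μ) := by
  obtain ⟨C, hC, hC0, hCle, hCtop, hCd⟩ :=
    hα.exists_disjoint_le (fun k => (2 ^ (k ^ 2))⁻¹) (by simp)
  -- The large sets are taken outside the union of the small ones, which has finite measure; even
  -- levels then use `C` and odd levels `E`.
  obtain ⟨E, hE, hEtop, hEle, hCE, hEd⟩ :=
    hβ.exists_disjoint_ge (fun k => 2 ^ (k ^ 2)) (by simp) (MeasurableSet.iUnion hC) hCtop
  have hCE' : ∀ k l, Disjoint (C k) (E l) := fun k l => (hCE l).mono_left (Set.subset_iUnion C k)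
  have hD : IsTreeFamily μ fun s : List Bool =>
      (if Even s.length then C else E) (Encodable.encode s) := by
    refine isTreeFamily_encode (X := fun s => if Even s.length then C else E) (fun s k => ?_)
      (fun s k => ?_) (fun s k => ?_) (fun s t k l h => ?_)
    · split_ifs
      exacts [hC k, hE k]
    · split_ifs
      exacts [hC0 k, ne_zero_of_two_pow_le (hEle k)]
    · split_ifs
      exacts [((measure_mono (Set.subset_iUnion C k)).trans_lt hCtop.lt_top).ne, hEtop k]
    · split_ifs
      exacts [hCd h, hCE' k l, (hCE' l k).symm, hEd h]
  refine hD.maximalDenseLineable_strict hp hp' (fun b => frequently_even fun n hn => ?_)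
    (fun b => frequently_not_even fun n hn => ?_) (exists_injective_prod_nat_bool hp hp' hent)
  · simpa [hn] using (hCle _).trans (inv_two_pow_encode_le (node b n))
  · simpa [hn] using (two_pow_le_two_pow_encode (node b n)).trans (hEle _)

end SmallEntropy

/-! ### Entropy above the continuum: the tree over the family. -/

section LargeEntropy

variable {Ω 𝕂 : Type*} [MeasurableSpace Ω] [RCLike 𝕂] {μ : Measure Ω} {p : ℝ≥0∞}
  {F : Set (Set Ω)}

theorem MuDisjoint.maximalDenseLineable_rStrict (hF : MuDisjoint μ F) (hcard : #F = ent μ)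
    (hinf : ℵ₀ ≤ #F) (hp : p ≠ 0) (hp' : p ≠ ∞) (hα : ∀ S ∈ F, CondAlphaOn μ S) :
    MaximalDenseLineable 𝕂 (lpTopology 𝕂 p μ hp) (rStrict 𝕂 p μ) := by
  obtain ⟨e⟩ := exists_equiv_list_prod_nat (G := (Set.univ : Set F)) hinf mk_univ.ge
  choose C hC hCsub hC0 hClt using fun s : List F =>
    (hα _ (e (s, 0)).1.2).exists_subset_lt (ε := (2 ^ (s.length ^ 2))⁻¹) (by simp)
  have hD : IsTreeFamily μ C :=
    { measurableSet := hC
      ne_zero := hC0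
      ne_top := fun s => ((hClt s).trans_le le_top).ne
      inter_null := measure_inter_null_of_subset_iUnion (X := fun i => (e i).1.1)
        (fun i j hij => hF.2 _ (e i).1.2 _ (e j).1.2 fun h =>
          hij (e.injective (Subtype.ext (Subtype.ext h))))
        fun s => Set.subset_iUnion_of_subset 0 (hCsub s) }
  refine hD.maximalDenseLineable_rStrict hp hp' (fun b => Filter.Frequently.of_forall fun n => ?_)
    (exists_injective_prod_nat_of_mk_eq hp hp' hcard hinf)
  simpa using (hClt (node b n)).le

/-- In a `μ`-disjoint family of sets of finite measure as numerous as the classes of sets of finite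
measure, there are sets `X (s, i)`, for `s` in the tree of finite sequences in the family, such that
`⋃ i, X (s, i)` contains sets of finite and arbitrarily large measure. -/
theorem MuDisjoint.exists_tree_large (hF : MuDisjoint μ F) (hcard : #F = ent μ) (hinf : ℵ₀ ≤ #F)
    (hfin : ∀ S ∈ F, μ S < ∞) :
    ∃ (X : List F × ℕ → F) (E : List F → Set Ω),
      (∀ i j, i ≠ j → μ ((X i).1 ∩ (X j).1) = 0) ∧ (∀ s, MeasurableSet (E s)) ∧
      (∀ s, E s ⊆ ⋃ i, (X (s, i)).1) ∧ (∀ s, μ (E s) ≠ ∞) ∧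
      ∀ s, 2 ^ (s.length ^ 2) ≤ μ (E s) := by
  obtain ⟨k, hk⟩ := hF.exists_mk_le_inv_two_pow_le hcard hinf
  obtain ⟨e⟩ := exists_equiv_list_prod_nat hinf hk
  have hnull : ∀ i j, i ≠ j → μ ((e i).1.1 ∩ (e j).1.1) = 0 := fun i j hij =>
    hF.2 _ (e i).1.2 _ (e j).1.2 fun h => hij (e.injective (Subtype.ext (Subtype.ext h)))
  choose E hE hEsub hEtop hEle using fun s : List F =>
    exists_finite_union_ge (X := fun i => (e (s, i)).1.1) (fun i => (hF.1 _ (e (s, i)).1.2).1)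
      (fun i j hij => hnull _ _ fun h => hij (congrArg Prod.snd h))
      (fun i => (hfin _ (e (s, i)).1.2).ne) (fun i => (e (s, i)).2) (s.length ^ 2)
  exact ⟨fun i => (e i).1, E, hnull, hE, hEsub, hEtop, hEle⟩

theorem MuDisjoint.maximalDenseLineable_lStrict (hF : MuDisjoint μ F) (hcard : #F = ent μ)
    (hinf : ℵ₀ ≤ #F) (hp : p ≠ 0) (hp' : p ≠ ∞) (hfin : ∀ S ∈ F, μ S < ∞) :
    MaximalDenseLineable 𝕂 (lpTopology 𝕂 p μ hp) (lStrict 𝕂 p μ) := by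
  obtain ⟨X, E, hnull, hE, hEsub, hEtop, hEle⟩ := hF.exists_tree_large hcard hinf hfin
  have hD : IsTreeFamily μ E :=
    { measurableSet := hE
      ne_zero := fun s => ne_zero_of_two_pow_le (hEle s)
      ne_top := hEtop
      inter_null := measure_inter_null_of_subset_iUnion hnull hEsub }
  refine hD.maximalDenseLineable_lStrict hp hp' (fun b => Filter.Frequently.of_forall fun n => ?_)
    (exists_injective_prod_nat_of_mk_eq hp hp' hcard hinf)
  simpa using hEle (node b n)

theorem MuDisjoint.maximalDenseLineable_strict (hF : MuDisjoint μ F) (hcard : #F = ent μ)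
    (hinf : ℵ₀ ≤ #F) (hp : p ≠ 0) (hp' : p ≠ ∞) (hfin : ∀ S ∈ F, μ S < ∞)
    (hα : ∀ S ∈ F, CondAlphaOn μ S) :
    MaximalDenseLineable 𝕂 (lpTopology 𝕂 p μ hp) (strict 𝕂 p μ) := by
  obtain ⟨X, E, hnull, hE, hEsub, hEtop, hEle⟩ := hF.exists_tree_large hcard hinf hfin
  -- `C s` lies in the same block `⋃ i, X (s, i)` as `E s`, so choosing either by parity keeps null
  -- intersections.
  choose C hC hCsub hC0 hClt using fun s : List F =>
    (hα _ (X (s, 0)).2).exists_subset_lt (ε := (2 ^ (s.length ^ 2))⁻¹) (by simp)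
  have hD : IsTreeFamily μ fun s => if Even s.length then C s else E s := by
    refine ⟨fun s => ?_, fun s => ?_, fun s => ?_,
      measure_inter_null_of_subset_iUnion hnull fun s => ?_⟩
    · split_ifs
      exacts [hC s, hE s]
    · split_ifs
      exacts [hC0 s, ne_zero_of_two_pow_le (hEle s)]
    · split_ifs
      exacts [((hClt s).trans_le le_top).ne, hEtop s]
    · split_ifs
      exacts [Set.subset_iUnion_of_subset 0 (hCsub s), hEsub s]
  refine hD.maximalDenseLineable_strict hp hp' (fun b => frequently_even fun n hn => ?_)
    (fun b => frequently_not_even fun n hn => ?_)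
    (exists_injective_prod_nat_of_mk_eq hp hp' hcard hinf)
  · simpa [hn] using (hClt (node b n)).le
  · simpa [hn] using hEle (node b n)

end LargeEntropy

end StrictLp
end

theorem theorem4p2 {Ω 𝕂 : Type*} [MeasurableSpace Ω] [RCLike 𝕂] (μ : Measure Ω)
    (p : ℝ≥0∞) (hp : p ≠ 0) (hp' : p ≠ ∞) (F : Set (Set Ω))
    (hF : 𝔠 < StrictLp.ent μ → StrictLp.MuDisjoint μ F ∧ #F = StrictLp.ent μ) :
    (StrictLp.CondAlpha μ → StrictLp.ent μ ≤ 𝔠 →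
      StrictLp.MaximalDenseLineable 𝕂 (StrictLp.lpTopology 𝕂 p μ hp)
        (StrictLp.rStrict 𝕂 p μ)) ∧
    (𝔠 < StrictLp.ent μ → (∀ S ∈ F, StrictLp.CondAlphaOn μ S) →
      StrictLp.MaximalDenseLineable 𝕂 (StrictLp.lpTopology 𝕂 p μ hp)
        (StrictLp.rStrict 𝕂 p μ)) ∧
    (StrictLp.CondBeta μ → StrictLp.ent μ ≤ 𝔠 →
      StrictLp.MaximalDenseLineable 𝕂 (StrictLp.lpTopology 𝕂 p μ hp)
        (StrictLp.lStrict 𝕂 p μ)) ∧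
    (𝔠 < StrictLp.ent μ → (∀ S ∈ F, μ S < ∞) →
      StrictLp.MaximalDenseLineable 𝕂 (StrictLp.lpTopology 𝕂 p μ hp)
        (StrictLp.lStrict 𝕂 p μ)) ∧
    (StrictLp.ent μ ≤ 𝔠 → StrictLp.CondAlpha μ → StrictLp.CondBeta μ →
      StrictLp.MaximalDenseLineable 𝕂 (StrictLp.lpTopology 𝕂 p μ hp)
        (StrictLp.strict 𝕂 p μ)) ∧
    (𝔠 < StrictLp.ent μ → (∀ S ∈ F, μ S < ∞) → (∀ S ∈ F, StrictLp.CondAlphaOn μ S) →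
      StrictLp.MaximalDenseLineable 𝕂 (StrictLp.lpTopology 𝕂 p μ hp)
        (StrictLp.strict 𝕂 p μ)) := by
  have hF' : 𝔠 < StrictLp.ent μ →
      StrictLp.MuDisjoint μ F ∧ #F = StrictLp.ent μ ∧ ℵ₀ ≤ #F := fun h =>
    ⟨(hF h).1, (hF h).2, (aleph0_le_continuum.trans h.le).trans_eq (hF h).2.symm⟩
  refine ⟨fun hα h => ?_, fun h hα => ?_, fun hβ h => ?_, fun h hfin => ?_, fun h hα hβ => ?_,
    fun h hfin hα => ?_⟩
  · exact StrictLp.maximalDenseLineable_rStrict_of_condAlpha hp hp' hα h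
  · obtain ⟨h1, h2, h3⟩ := hF' h
    exact h1.maximalDenseLineable_rStrict h2 h3 hp hp' hα
  · exact StrictLp.maximalDenseLineable_lStrict_of_condBeta hp hp' hβ h
  · obtain ⟨h1, h2, h3⟩ := hF' h
    exact h1.maximalDenseLineable_lStrict h2 h3 hp hp' hfin
  · exact StrictLp.maximalDenseLineable_strict_of_condAlpha_of_condBeta hp hp' hα hβ h
  · obtain ⟨h1, h2, h3⟩ := hF' h
    exact h1.maximalDenseLineable_strict h2 h3 hp hp' hfin hα
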